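/- Call a metric space $Y$ $(M,s)$-homogeneous if, for all $0<\rho<r$, every ball of radius $r$ in $Y$ can be covered by at most $M(r/\rho)^s$ balls of radius $\rho$, and let the Assouad dimension $d_{\rm A}(Y)\in[-\infty,+\infty]$ be the infimum of all $s\in\mathbb R$ such that $Y$ is $(M,s)$-homogeneous for some $M\ge1$ ($+\infty$ if there is no such $s$). A subset $S$ of a normed space $V$ is prevalent if there are a Borel set $S'\subseteq S$ and a compactly supported Borel probability measure $\mu$ on $V$ with $\mu(v+S')=1$ for every $v\in V$. **Theorem 3.1.** Let $X$ be a compact subset of a real Banach space $B$, and let $N\in\mathbb N$ and $d\in\mathbb R$ satisfy $d_{\rm A}(X-X)<d<N$, where $X-X=\{x-y: x,y\in X\}$. Let $$\gamma>\frac{\alpha N+1}{N-d},$$ where $\alpha=1$ for a general Banach space $B$, and $\alpha=\tfrac12$ if $B$ is a Hilbert space. Then the set of those bounded linear maps $L:B\to\mathbb R^N$ that have the following property is prevalent in the space $\mathscr L(B,\mathbb R^N)$ with the operator norm: there are constants $c_L>0$ and $\rho_L\in(0,1)$ such that $$\frac1{c_L}\,\frac{\|x-y\|}{\bigl|\log\|x-y\|\bigr|^{\gamma}}\le|Lx-Ly|\le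 c_L\|x-y\|$$ for all $x,y\in X$ with $0<\|x-y\|\le\rho_L$, where $|\cdot|$ is the Euclidean norm on $\mathbb R^N$. -/

import Mathlib

open MeasureTheory
open scoped Pointwise

/-- A metric space `Y` is `(M, s)`-homogeneous if every ball of radius `r` can be covered by at most
`M (r / ρ) ^ s` smaller balls of radius `ρ`. -/
def IsHomogeneousSpace (Y : Type*) [MetricSpace Y] (M s : ℝ) : Prop :=
  ∀ r ρ : ℝ, 0 < ρ → ρ < r → ∀ y : Y, ∃ t : Finset Y,
    (t.card : ℝ) ≤ M * (r / ρ) ^ s ∧ Metric.ball y r ⊆ ⋃ z ∈ t, Metric.ball z ρ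

/-- The Assouad dimension of a metric space: the infimum of all `s` such that the space is
`(M, s)`-homogeneous for some `M ≥ 1`. It is `⊤` if there is no such `s`. It is nonnegative for a
nonempty space, and `⊥` for the empty space. -/
noncomputable def assouadDim (Y : Type*) [MetricSpace Y] : EReal :=
  ⨅ (s : ℝ) (_ : ∃ M : ℝ, 1 ≤ M ∧ IsHomogeneousSpace Y M s), (s : EReal)

/-- A subset `S` of a normed space `V` is prevalent if it contains a Borel set `S'` for which there
is a compactly supported Borel probability measure `μ` on `V` such that `μ (v + S') = 1` for every
`v` in `V`. -/
def IsPrevalent {V : Type*} [NormedAddCommGroup V] [NormedSpace ℝ V] [MeasurableSpace V]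
    [BorelSpace V] (S : Set V) : Prop :=
  ∃ S' : Set V, S' ⊆ S ∧ MeasurableSet S' ∧
    ∃ μ : Measure V, IsProbabilityMeasure μ ∧ (∃ K : Set V, IsCompact K ∧ μ Kᶜ = 0) ∧
      ∀ v : V, μ ((fun w => v + w) '' S') = 1

/-- The bounded linear map `L` into Euclidean space is `γ`-almost bi-Lipschitz on `X`. The threshold
`ρ` is taken less than `1`, so that the logarithm below does not vanish when `x ≠ y`; for `x = y` all
three terms are zero. -/
def IsAlmostBiLipschitzOn {B : Type*} [NormedAddCommGroup B] [NormedSpace ℝ B] {N : ℕ}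
    (γ : ℝ) (L : B →L[ℝ] EuclideanSpace ℝ (Fin N)) (X : Set B) : Prop :=
  ∃ c ρ : ℝ, 0 < c ∧ 0 < ρ ∧ ρ < 1 ∧ ∀ x ∈ X, ∀ y ∈ X, ‖x - y‖ ≤ ρ →
    1 / c * (‖x - y‖ / |Real.log ‖x - y‖| ^ γ) ≤ ‖L x - L y‖ ∧ ‖L x - L y‖ ≤ c * ‖x - y‖

/-! A random operator works: its coordinates are independent copies of `∑ (k+1)^(-β) ξ k • e k`,
with Gaussian `ξ` conditioned on `|ξ k| ≤ A (k+1)^δ` and `β = α + 2δ`. Conditioning makes the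
support compact and costs only a constant factor in small-ball bounds.

Finite Assouad dimension lets boundedly many centres serve each dyadic shell of `X - X`. Enumerating
them shell by shell and choosing norming functionals `e`, the value at a point of shell `j` has
conditional density `≲ 2^j (j+1)^β`. Hence, after any shift `v`, the image has norm `≲ 2^(-j)
(j+1)^(-γ)` with probability `≲ (j+1)^((β-γ)N)`. A net at that scale has `≲ (j+1)^(γd)` points, so
the shell fails with probability `≲ (j+1)^(γd+(β-γ)N)`, summable exactly when `γ(N-d) > βN+1`;
Borel–Cantelli concludes. The value of `α` is the price of convergence of the series: `ℓ¹` control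
in a Banach space, `ℓ²` control (Gram–Schmidt) in a Hilbert space.

The carriers are `exists_probability_powerBox`, `hasNormingSequences_one`,
`hasNormingSequences_half`, `exists_continuous_series` and `measure_pi_small_ball_le`. -/

/-! ### Gaussian sequences and their truncation to a compact box. -/

section Gaussian

open ProbabilityTheory Measure
open scoped NNReal ENNReal

/-- A countable product of standard Gaussian measures. -/
noncomputable def gaussianSeq : Measure (ℕ → ℝ) := infinitePi fun _ => gaussianReal 0 1

instance : IsProbabilityMeasure gaussianSeq := by
  unfold gaussianSeq; infer_instance

lemma gaussianSeq_map_eval (k : ℕ) : gaussianSeq.map (fun x => x k) = gaussianReal 0 1 :=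
  infinitePi_map_eval _ k

lemma gaussianSeq_map_sum (F : Finset ℕ) (c : ℕ → ℝ) :
    gaussianSeq.map (fun x => ∑ k ∈ F, c k * x k) =
      gaussianReal 0 (∑ k ∈ F, c k ^ 2).toNNReal := by
  have hind : iIndepFun (fun k (x : ℕ → ℝ) => c k * x k) gaussianSeq :=
    iIndepFun_infinitePi (X := fun k (t : ℝ) => c k * t) (fun k => by fun_prop)
  refine Measure.ext_of_charFun ?_
  rw [(hind.precomp (g := ((↑) : F → ℕ)) Subtype.val_injective).charFun_map_fun_finsetSum_eq_prod
    fun k _ => ((measurable_pi_apply (k : ℕ)).const_mul _).aemeasurable]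
  ext t
  have hk (k : ℕ) : charFun (gaussianSeq.map fun x => c k * x k) t =
      Complex.exp (-(c k ^ 2 * t ^ 2 / 2 : ℝ)) := by
    have : gaussianSeq.map (fun x => c k * x k) = gaussianReal 0 (c k ^ 2).toNNReal := by
      have h := gaussianReal_map_const_mul (μ := 0) (v := 1) (c k)
      rw [← gaussianSeq_map_eval k, map_map (by fun_prop) (by fun_prop)] at h
      rw [show (fun x : ℕ → ℝ => c k * x k) = (c k * ·) ∘ fun x => x k from rfl, h]
      congr 1
      · simp
      · ext; simp [sq_nonneg]
    rw [this, charFun_gaussianReal]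
    simp [Real.coe_toNNReal _ (sq_nonneg (c k))]
  simp only [Finset.prod_apply, hk, charFun_gaussianReal]
  rw [← Complex.exp_sum]
  congr 1
  rw [Real.coe_toNNReal _ (Finset.sum_nonneg fun k _ => sq_nonneg _)]
  push_cast
  simp [Finset.sum_mul, Finset.sum_div]

/-- The density is at most `1 / √(2πv) ≤ 1 / (2√v)`, wherever the interval is centred. -/
lemma gaussianReal_Icc_le (m : ℝ) {v : ℝ≥0} (hv : v ≠ 0) (a : ℝ) {η : ℝ} :
    gaussianReal m v (Set.Icc (a - η) (a + η)) ≤ ENNReal.ofReal (η / √v) := by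
  rw [gaussianReal_apply _ hv]
  have hv' : 0 < √(v : ℝ) := Real.sqrt_pos.2 (by positivity)
  calc ∫⁻ x in Set.Icc (a - η) (a + η), gaussianPDF m v x
      ≤ ∫⁻ x in Set.Icc (a - η) (a + η), ENNReal.ofReal (1 / (2 * √v)) := by
        refine lintegral_mono fun x => ENNReal.ofReal_le_ofReal ?_
        rw [gaussianPDFReal_def, one_div]
        have h1 : Real.exp (-(x - m) ^ 2 / (2 * v)) ≤ 1 := by
          rw [Real.exp_le_one_iff]
          apply div_nonpos_of_nonpos_of_nonneg <;> [nlinarith [sq_nonneg (x - m)]; positivity]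
        have h2 : 2 * √(v : ℝ) ≤ √(2 * Real.pi * v) := by
          apply Real.le_sqrt_of_sq_le
          rw [mul_pow, Real.sq_sqrt (by positivity)]
          nlinarith [Real.pi_gt_three, v.2]
        calc _ ≤ (√(2 * Real.pi * v))⁻¹ * 1 := mul_le_mul_of_nonneg_left h1 (by positivity)
          _ ≤ _ := by rw [mul_one]; gcongr
    _ = ENNReal.ofReal (η / √v) := by
        rw [setLIntegral_const, Real.volume_Icc, ← ENNReal.ofReal_mul (by positivity)]
        congr 1
        field_simp
        ring

lemma gaussianSeq_abs_add_sum_le {F : Finset ℕ} {c : ℕ → ℝ} {σ : ℝ} (hσ : 0 < σ)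
    (h : σ ^ 2 ≤ ∑ k ∈ F, c k ^ 2) (a : ℝ) {η : ℝ} (hη : 0 ≤ η) :
    gaussianSeq {x | |a + ∑ k ∈ F, c k * x k| ≤ η} ≤ ENNReal.ofReal (η / σ) := by
  have hpos : 0 < ∑ k ∈ F, c k ^ 2 := lt_of_lt_of_le (by positivity) h
  have hset : {x : ℕ → ℝ | |a + ∑ k ∈ F, c k * x k| ≤ η} =
      (fun x => ∑ k ∈ F, c k * x k) ⁻¹' Set.Icc (-a - η) (-a + η) := by
    ext x
    simp only [Set.mem_ofPred_eq, Set.mem_preimage, Set.mem_Icc, abs_le]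
    constructor <;> rintro ⟨h1, h2⟩ <;> constructor <;> linarith
  rw [hset, ← map_apply (by fun_prop) measurableSet_Icc, gaussianSeq_map_sum]
  refine (gaussianReal_Icc_le 0 (by simpa using hpos) (-a)).trans ?_
  refine ENNReal.ofReal_le_ofReal ?_
  rw [Real.coe_toNNReal _ hpos.le]
  gcongr
  exact Real.le_sqrt_of_sq_le h

/-- Sequences growing at most like a small power are charged by `gaussianSeq`. -/
lemma exists_gaussianSeq_box_ne_zero {δ : ℝ} (hδ : 0 < δ) :
    ∃ A : ℝ, 0 < A ∧ gaussianSeq {x | ∀ k : ℕ, |x k| ≤ A * (k + 1 : ℝ) ^ δ} ≠ 0 := by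
  -- With `p = 2/δ`, Markov's inequality for the `p`-th moment gives the summable tail `1/(k+1)^2`.
  obtain ⟨p, hp⟩ : ∃ p : ℝ≥0, (p : ℝ) = 2 / δ :=
    ⟨(2 / δ).toNNReal, Real.coe_toNNReal _ (by positivity)⟩
  have hp0 : (p : ℝ≥0∞) ≠ 0 := by
    rw [Ne, ENNReal.coe_eq_zero, ← NNReal.coe_eq_zero, hp]; positivity
  have hLp := memLp_id_gaussianReal (μ := 0) (v := 1) p
  have htail (k : ℕ) : gaussianSeq {x | (k + 1 : ℝ) ^ δ < |x k|} ≤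
      eLpNorm id p (gaussianReal 0 1) ^ (p : ℝ) * ENNReal.ofReal (1 / ((k : ℝ) + 1) ^ 2) := by
    have hset : {x : ℕ → ℝ | (k + 1 : ℝ) ^ δ < |x k|} =
        (fun x => x k) ⁻¹' {t | (k + 1 : ℝ) ^ δ < |t|} := rfl
    rw [hset, ← map_apply (measurable_pi_apply k)
      (measurableSet_lt measurable_const (by fun_prop)),
      gaussianSeq_map_eval]
    have hm := mul_meas_ge_le_pow_eLpNorm' (gaussianReal 0 1) hp0 ENNReal.coe_ne_top
      hLp.aestronglyMeasurable (ENNReal.ofReal ((k + 1 : ℝ) ^ δ))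
    have hpow : ENNReal.ofReal ((k + 1 : ℝ) ^ δ) ^ (p : ℝ) = ENNReal.ofReal (((k : ℝ) + 1) ^ 2) := by
      rw [ENNReal.ofReal_rpow_of_nonneg (by positivity) (by positivity),
        ← Real.rpow_mul (by positivity)]
      congr 1
      rw [hp, mul_div_cancel₀ _ hδ.ne']
      exact Real.rpow_two _
    rw [ENNReal.coe_toReal, hpow] at hm
    rw [one_div, ENNReal.ofReal_inv_of_pos (by positivity), ← div_eq_mul_inv,
      ENNReal.le_div_iff_mul_le (by left; simp; positivity) (by simp), mul_comm]
    refine le_trans ?_ hm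
    gcongr with t
    intro ht
    rw [id, ← ofReal_norm]
    exact ENNReal.ofReal_le_ofReal ht.le
  have hsum : ∑' k : ℕ, gaussianSeq {x | (k + 1 : ℝ) ^ δ < |x k|} ≠ ∞ := by
    refine ne_top_of_le_ne_top ?_ (ENNReal.tsum_le_tsum htail)
    rw [ENNReal.tsum_mul_left]
    refine ENNReal.mul_ne_top (ENNReal.rpow_ne_top_of_nonneg p.2 hLp.2.ne) ?_
    refine Summable.tsum_ofReal_ne_top ?_
    exact_mod_cast (summable_nat_add_iff 1).2 (Real.summable_one_div_nat_pow.2 one_lt_two)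
  have hae := ae_eventually_notMem hsum
  -- By Borel–Cantelli almost every sequence lies in some box of integer size, the size absorbing
  -- finitely many early terms; these boxes cannot all be null.
  by_contra! hcon
  have hnull : gaussianSeq (⋃ n : ℕ, {x | ∀ k : ℕ, |x k| ≤ (n + 1 : ℝ) * (k + 1 : ℝ) ^ δ}) = 0 :=
    measure_iUnion_null fun n => hcon _ (by positivity)
  have htop : ∀ᵐ x ∂gaussianSeq,
      x ∈ ⋃ n : ℕ, {x : ℕ → ℝ | ∀ k : ℕ, |x k| ≤ (n + 1 : ℝ) * (k + 1 : ℝ) ^ δ} := by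
    filter_upwards [hae] with x hx
    obtain ⟨k₀, hk₀⟩ := Filter.eventually_atTop.1 hx
    obtain ⟨n, hn⟩ := exists_nat_ge (∑ k ∈ Finset.range k₀, |x k|)
    refine Set.mem_iUnion.2 ⟨n, fun k => ?_⟩
    have h1 : (1 : ℝ) ≤ (k + 1 : ℝ) ^ δ := Real.one_le_rpow (by simp) hδ.le
    rcases le_or_gt k₀ k with hk | hk
    · have := hk₀ k hk
      simp only [not_lt] at this
      nlinarith [Nat.cast_nonneg (α := ℝ) n]
    · have : |x k| ≤ ∑ k ∈ Finset.range k₀, |x k| :=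
        Finset.single_le_sum (f := fun k => |x k|) (fun _ _ => abs_nonneg _)
          (Finset.mem_range.2 hk)
      nlinarith [Nat.cast_nonneg (α := ℝ) n]
  have h0 : ∀ᵐ x ∂gaussianSeq, False := by
    filter_upwards [htop, measure_eq_zero_iff_ae_notMem.1 hnull] with x h1 h2 using h2 h1
  exact IsProbabilityMeasure.ne_zero gaussianSeq (by simpa using h0)

/-- The sequences bounded by `A * (k + 1) ^ δ`. -/
def powerBox (A δ : ℝ) : Set (ℕ → ℝ) := {x | ∀ k : ℕ, |x k| ≤ A * (k + 1 : ℝ) ^ δ}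

lemma isCompact_powerBox (A δ : ℝ) : IsCompact (powerBox A δ) := by
  convert isCompact_univ_pi fun k : ℕ =>
    isCompact_Icc (a := -(A * (k + 1 : ℝ) ^ δ)) (b := A * (k + 1 : ℝ) ^ δ)
  ext x
  simp [powerBox, abs_le, Pi.le_def, forall_and]

/-- The truncation of `gaussianSeq` to a suitable box has uniformly bounded densities for its
linear marginals. -/
lemma exists_probability_powerBox {δ : ℝ} (hδ : 0 < δ) :
    ∃ A C : ℝ, 0 < A ∧ 0 < C ∧ ∃ ν : Measure (powerBox A δ), IsProbabilityMeasure ν ∧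
      ∀ (F : Finset ℕ) (c : ℕ → ℝ) (σ a η : ℝ), 0 < σ → σ ^ 2 ≤ ∑ k ∈ F, c k ^ 2 → 0 ≤ η →
        ν {x | |a + ∑ k ∈ F, c k * x.1 k| ≤ η} ≤ ENNReal.ofReal (C * (η / σ)) := by
  obtain ⟨A, hA, hbox⟩ := exists_gaussianSeq_box_ne_zero hδ
  change gaussianSeq (powerBox A δ) ≠ 0 at hbox
  have hmeas : MeasurableSet (powerBox A δ) := (isCompact_powerBox A δ).measurableSet
  set q := gaussianSeq (powerBox A δ) with hq
  have hqtop : q ≠ ∞ := measure_ne_top _ _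
  -- Conditioning on the box multiplies probabilities by at most `q⁻¹`.
  refine ⟨A, q⁻¹.toReal, hA, ENNReal.toReal_pos (by simpa using hqtop) (by simpa using hbox),
    q⁻¹ • gaussianSeq.comap Subtype.val, ⟨?_⟩, fun F c σ a η hσ h hη => ?_⟩
  · rw [Measure.smul_apply, comap_subtype_coe_apply hmeas, Set.image_univ, Subtype.range_coe,
      smul_eq_mul]
    exact ENNReal.inv_mul_cancel hbox hqtop
  · rw [Measure.smul_apply, comap_subtype_coe_apply hmeas, smul_eq_mul,
      ENNReal.ofReal_mul ENNReal.toReal_nonneg, ENNReal.ofReal_toReal (by simpa using hbox)]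
    gcongr
    refine (measure_mono ?_).trans (gaussianSeq_abs_add_sum_le hσ h a hη)
    rintro _ ⟨x, hx, rfl⟩
    exact hx

end Gaussian

/-! ### Norming functionals in Banach and Hilbert spaces. -/

/-- Every sequence `u` in `B` admits functionals `e` whose linear combinations are controlled by an
`ℓ^(1/α)` norm of the coefficients, and such that `e 0, …, e k` jointly detect each point `z` close
to `u k`. -/
def HasNormingSequences (B : Type*) [NormedAddCommGroup B] [NormedSpace ℝ B] (α : ℝ) : Prop :=
  ∀ u : ℕ → B, ∃ e : ℕ → StrongDual ℝ B,
    (∀ (s : Finset ℕ) (x : ℕ → ℝ), ‖∑ k ∈ s, x k • e k‖ ≤ (∑ k ∈ s, |x k| ^ (1 / α)) ^ α) ∧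
    ∀ k z, ‖z - u k‖ ≤ ‖u k‖ / 2 →
      (‖u k‖ / 2) ^ 2 ≤ ∑ i ∈ Finset.range (k + 1), (e i z) ^ 2

/-- Hahn–Banach supplies a norming functional for each `u k`; the `k`-th one alone already detects
`z`. -/
lemma hasNormingSequences_one (B : Type*) [NormedAddCommGroup B] [NormedSpace ℝ B] :
    HasNormingSequences B 1 := by
  intro u
  choose e he1 he2 using fun k => exists_dual_vector'' ℝ (u k)
  refine ⟨e, fun s x => ?_, fun k z hz => ?_⟩
  · simp only [div_one, Real.rpow_one]
    refine (norm_sum_le _ _).trans (Finset.sum_le_sum fun k _ => ?_)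
    rw [norm_smul, Real.norm_eq_abs]
    exact mul_le_of_le_one_right (abs_nonneg _) (he1 k)
  · refine le_trans ?_ (Finset.single_le_sum (f := fun i => (e i z) ^ 2)
      (fun i _ => sq_nonneg _) (Finset.self_mem_range_succ k))
    have h1 : |e k (z - u k)| ≤ ‖z - u k‖ := by
      simpa using (e k).le_of_opNorm_le (he1 k) (z - u k)
    have h2 : e k (u k) = ‖u k‖ := he2 k
    rw [map_sub, h2] at h1
    have h3 : ‖u k‖ / 2 ≤ e k z := by linarith [(abs_le.1 h1).1]
    gcongr

/-- Gram–Schmidt gives orthogonal functionals, so Pythagoras controls sums, while `u k` lies in the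
span of `e 0, …, e k`. -/
lemma hasNormingSequences_half (H : Type*) [NormedAddCommGroup H] [InnerProductSpace ℝ H] :
    HasNormingSequences H (1 / 2) := by
  intro u
  set e : ℕ → H := InnerProductSpace.gramSchmidtNormed ℝ u with he
  have horth {i j : ℕ} (hij : i ≠ j) : inner ℝ (e i) (e j) = (0 : ℝ) := by
    simp [he, InnerProductSpace.gramSchmidtNormed, inner_smul_left, inner_smul_right,
      InnerProductSpace.gramSchmidt_orthogonal ℝ u hij]
  have hnorm (i : ℕ) : inner ℝ (e i) (e i) ≤ (1 : ℝ) := by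
    rw [real_inner_self_eq_norm_sq]
    by_cases h : e i = 0
    · simp [h]
    · rw [InnerProductSpace.gramSchmidtNormed_unit_length' h, one_pow]
  have hsq (s : Finset ℕ) (x : ℕ → ℝ) : inner ℝ (∑ k ∈ s, x k • e k) (∑ k ∈ s, x k • e k) =
      ∑ k ∈ s, x k ^ 2 * inner ℝ (e k) (e k) := by
    simp only [sum_inner, inner_sum, inner_smul_left, inner_smul_right]
    refine Finset.sum_congr rfl fun k hk => ?_
    rw [Finset.sum_eq_single k (fun j _ hj => by rw [horth hj]; simp) (fun h => absurd hk h)]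
    simp; ring
  refine ⟨fun k => innerSL ℝ (e k), fun s x => ?_, fun k z hz => ?_⟩
  · have : ∑ k ∈ s, x k • innerSL ℝ (e k) = innerSL ℝ (∑ k ∈ s, x k • e k) := by
      simp [map_sum]
    rw [this, innerSL_apply_norm, ← Real.sqrt_eq_rpow]
    apply Real.le_sqrt_of_sq_le
    rw [← real_inner_self_eq_norm_sq, hsq]
    refine Finset.sum_le_sum fun k _ => ?_
    rw [one_div_one_div, Real.rpow_two, sq_abs]
    exact mul_le_of_le_one_right (sq_nonneg _) (hnorm k)
  · have hmem : u k ∈ Submodule.span ℝ (e '' Set.Iic k) := by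
      rw [he, InnerProductSpace.span_gramSchmidtNormed, InnerProductSpace.span_gramSchmidt_Iic]
      exact Submodule.subset_span ⟨k, by simp, rfl⟩
    rw [show Set.Iic k = (Finset.range (k + 1) : Set ℕ) by ext; simp,
      Submodule.mem_span_image_finset_iff_exists_fun'] at hmem
    obtain ⟨c, hc⟩ := hmem
    -- Gram–Schmidt returns zero at linearly dependent vectors, so `‖e i‖` is 0 or 1 and is carried
    -- along.
    have hproj (i : ℕ) : ‖e i‖ * inner ℝ (e i) z = inner ℝ (e i) z := by
      by_cases h : e i = 0
      · simp [h]
      · rw [InnerProductSpace.gramSchmidtNormed_unit_length' h, one_mul]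
    have hu : ‖u k‖ ^ 2 = ∑ i ∈ Finset.range (k + 1), (c i * ‖e i‖) ^ 2 := by
      rw [← real_inner_self_eq_norm_sq, ← hc, hsq]
      simp [mul_pow]
    have hin : inner ℝ (u k) z =
        ∑ i ∈ Finset.range (k + 1), (c i * ‖e i‖) * inner ℝ (e i) z := by
      rw [← hc, sum_inner]
      refine Finset.sum_congr rfl fun i _ => ?_
      rw [mul_assoc, hproj, real_inner_smul_left]
    have hcs := Finset.sum_mul_sq_le_sq_mul_sq (Finset.range (k + 1)) (fun i => c i * ‖e i‖)
      fun i => inner ℝ (e i) z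
    rw [← hin, ← hu] at hcs
    have hlow : ‖u k‖ ^ 2 / 2 ≤ inner ℝ (u k) z := by
      have h1 : inner ℝ (u k) z = ‖u k‖ ^ 2 + inner ℝ (u k) (z - u k) := by
        rw [inner_sub_right, real_inner_self_eq_norm_sq]; ring
      have h2 := (abs_le.1 (abs_real_inner_le_norm (u k) (z - u k))).1
      nlinarith [mul_le_mul_of_nonneg_left hz (norm_nonneg (u k))]
    rcases (norm_nonneg (u k)).eq_or_lt with h0 | h0
    · rw [← h0]
      simpa using Finset.sum_nonneg fun i (_ : i ∈ Finset.range (k + 1)) =>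
        sq_nonneg (inner ℝ (e i) z)
    · have h3 : (‖u k‖ ^ 2 / 2) ^ 2 ≤ (inner ℝ (u k) z) ^ 2 := by gcongr
      refine le_of_mul_le_mul_left ?_ (pow_pos h0 2)
      refine le_trans (le_of_eq ?_) (h3.trans hcs)
      ring

/-! ### Coarse and fine covers of dyadic shells. -/

section Covers

variable {B : Type*} [NormedAddCommGroup B]

lemma exists_cover_of_assouadDim_lt {Z : Set B} {d : ℝ} (hd : assouadDim Z < (d : EReal))
    (h0 : Z.Nonempty → (0 : B) ∈ Z) :
    ∃ M : ℝ, 1 ≤ M ∧ ∀ r ρ : ℝ, 0 < ρ → ρ < r → ∃ t : Finset B, (t.card : ℝ) ≤ M * (r / ρ) ^ d ∧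
      ∀ z ∈ Z, ‖z‖ < r → ∃ c ∈ t, ‖z - c‖ < ρ := by
  classical
  simp only [assouadDim, iInf_lt_iff] at hd
  obtain ⟨s, ⟨M, hM, hom⟩, hs⟩ := hd
  have hsd : s < d := by exact_mod_cast hs
  refine ⟨M, hM, fun r ρ hρ hr => ?_⟩
  have hone : 1 ≤ r / ρ := (one_le_div hρ).2 hr.le
  rcases Z.eq_empty_or_nonempty with rfl | hne
  · exact ⟨∅, by simp only [Finset.card_empty, Nat.cast_zero]; positivity, by simp⟩
  obtain ⟨t, ht, hcov⟩ := hom r ρ hρ hr ⟨0, h0 hne⟩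
  refine ⟨t.image Subtype.val, ?_, fun z hz hzr => ?_⟩
  · calc ((t.image Subtype.val).card : ℝ) ≤ t.card := by exact_mod_cast Finset.card_image_le
      _ ≤ M * (r / ρ) ^ s := ht
      _ ≤ M * (r / ρ) ^ d := by gcongr
  · have hz' : (⟨z, hz⟩ : Z) ∈ Metric.ball (⟨0, h0 hne⟩ : Z) r := by
      rw [Metric.mem_ball, Subtype.dist_eq]; simpa using hzr
    obtain ⟨c, hc, hzc⟩ := Set.mem_iUnion₂.1 (hcov hz')
    refine ⟨c, Finset.mem_image_of_mem _ hc, ?_⟩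
    rw [Metric.mem_ball, Subtype.dist_eq, dist_eq_norm] at hzc
    exact hzc

/-- The points of `Z` in the `j`-th dyadic annulus. -/
def dyadicShell (Z : Set B) (j : ℕ) : Set B :=
  {z | z ∈ Z ∧ (1 / 2 : ℝ) ^ (j + 1) < ‖z‖ ∧ ‖z‖ ≤ (1 / 2) ^ j}

/-- The ratio of the two radii is 16 at every scale, so one bound `K` on the number of centres
serves all shells. -/
lemma exists_coarse_centres {Z : Set B} {d : ℝ} (hd : assouadDim Z < (d : EReal))
    (h0 : Z.Nonempty → (0 : B) ∈ Z) :
    ∃ (u : ℕ → B) (K : ℕ), 0 < K ∧ ∀ j, ∀ z ∈ dyadicShell Z j, ∃ k < K * (j + 1),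
      ‖z - u k‖ ≤ ‖u k‖ / 2 ∧ (1 / 2 : ℝ) ^ (j + 3) ≤ ‖u k‖ / 2 := by
  obtain ⟨M, hM, hcov⟩ := exists_cover_of_assouadDim_lt hd h0
  have hpos (j : ℕ) : (0 : ℝ) < (1 / 2) ^ j := by positivity
  have hlt (j : ℕ) : (1 / 2 : ℝ) ^ (j + 3) < 2 * (1 / 2) ^ j := by
    have := hpos j; rw [pow_add]; linarith
  choose t ht hcov using fun j : ℕ => hcov (2 * (1 / 2) ^ j) ((1 / 2) ^ (j + 3)) (hpos _) (hlt j)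
  have hratio (j : ℕ) : (2 * (1 / 2 : ℝ) ^ j) / (1 / 2) ^ (j + 3) = 16 := by
    rw [pow_add]; field_simp; norm_num
  set K := ⌈M * 16 ^ d⌉₊ with hK
  have hcard (j : ℕ) : (t j).card ≤ K := by
    have := ht j
    rw [hratio] at this
    exact_mod_cast this.trans (Nat.le_ceil _)
  have hKpos : 0 < K := Nat.ceil_pos.2 (by positivity)
  -- Shell `j` occupies the block of indices `K * j, …, K * j + K - 1`, padded with zeros.
  refine ⟨fun k => (t (k / K)).toList.getD (k % K) 0, K, hKpos, fun j z hz => ?_⟩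
  obtain ⟨c, hc, hzc⟩ := hcov j z hz.1 (by linarith [hz.2.2, hpos j])
  obtain ⟨i, hi, hic⟩ := List.getElem_of_mem (Finset.mem_toList.2 hc)
  have hiK : i < K := lt_of_lt_of_le (by simpa using hi) (hcard j)
  have hdiv : (K * j + i) / K = j := by
    rw [Nat.mul_add_div hKpos, Nat.div_eq_of_lt hiK, add_zero]
  have hmod : (K * j + i) % K = i := by rw [Nat.mul_add_mod, Nat.mod_eq_of_lt hiK]
  refine ⟨K * j + i, by rw [mul_add]; omega, ?_⟩
  simp only [hdiv, hmod, List.getD_eq_getElem _ _ hi, hic]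
  have h1 : ‖z‖ ≤ ‖z - c‖ + ‖c‖ := by simpa using norm_add_le (z - c) c
  have h2 := hz.2.1
  have h3 := hpos j
  rw [pow_add] at hzc h2 ⊢
  constructor <;> linarith

lemma exists_fine_centres {Z : Set B} {d : ℝ} (hd : assouadDim Z < (d : EReal))
    (h0 : Z.Nonempty → (0 : B) ∈ Z) {γ : ℝ} (hγ : 0 < γ) :
    ∃ M : ℝ, 0 ≤ M ∧ ∀ j : ℕ, ∃ t : Finset B, (t : Set B) ⊆ dyadicShell Z j ∧
      (t.card : ℝ) ≤ M * (2 * (j + 1 : ℝ) ^ γ) ^ d ∧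
      ∀ z ∈ dyadicShell Z j, ∃ c ∈ t, ‖z - c‖ ≤ 2 * ((1 / 2) ^ j * (j + 1 : ℝ) ^ (-γ)) := by
  classical
  obtain ⟨M, hM, hcov⟩ := exists_cover_of_assouadDim_lt hd h0
  refine ⟨M, by linarith, fun j => ?_⟩
  have hpos : (0 : ℝ) < (1 / 2) ^ j := by positivity
  set ρ : ℝ := (1 / 2) ^ j * (j + 1 : ℝ) ^ (-γ) with hρ
  have hρpos : 0 < ρ := by positivity
  have hle : (j + 1 : ℝ) ^ (-γ) ≤ 1 := Real.rpow_le_one_of_one_le_of_nonpos (by simp) (by linarith)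
  obtain ⟨t, ht, hcov⟩ := hcov (2 * (1 / 2) ^ j) ρ hρpos (by nlinarith)
  have hratio : 2 * (1 / 2) ^ j / ρ = 2 * (j + 1 : ℝ) ^ γ := by
    rw [hρ, Real.rpow_neg (by positivity)]; field_simp
  rw [hratio] at ht
  -- Centres are moved into the shell, doubling the radius, because the variance bound holds only at
  -- points of the shell.
  set P : B → Prop := fun c => ∃ z ∈ dyadicShell Z j, ‖z - c‖ < ρ with hP
  have hsel (c : B) : ∃ z, P c → z ∈ dyadicShell Z j ∧ ‖z - c‖ < ρ := by
    by_cases h : P c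
    · exact h.imp fun z hz _ => hz
    · exact ⟨0, fun h' => absurd h' h⟩
  choose f hf using hsel
  refine ⟨(t.filter P).image f, ?_, ?_, fun z hz => ?_⟩
  · intro x hx
    obtain ⟨c, hc, rfl⟩ := Finset.mem_image.1 (Finset.mem_coe.1 hx)
    exact (hf c (Finset.mem_filter.1 hc).2).1
  · refine le_trans ?_ ht
    exact_mod_cast Finset.card_image_le.trans (Finset.card_filter_le _ _)
  · obtain ⟨c, hc, hzc⟩ := hcov z hz.1 (by linarith [hz.2.2])
    have hPc : P c := ⟨z, hz, hzc⟩
    refine ⟨f c, Finset.mem_image_of_mem _ (Finset.mem_filter.2 ⟨hc, hPc⟩), ?_⟩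
    have h1 : ‖z - f c‖ ≤ ‖z - c‖ + ‖f c - c‖ := by
      simpa using norm_sub_le (z - c) (f c - c)
    linarith [(hf c hPc).2]

end Covers

/-! ### Random series of functionals and operators built from them. -/

section RandomOperator

open Filter Topology

/-- The norm bound on finite sums makes tails small uniformly over `S`, so the sum is a uniform
limit of functions of finitely many coordinates. -/
lemma exists_continuous_series {E : Type*} [NormedAddCommGroup E] [NormedSpace ℝ E]
    [CompleteSpace E] {α : ℝ} (hα : 0 < α) {e : ℕ → E}
    (he : ∀ (s : Finset ℕ) (x : ℕ → ℝ), ‖∑ k ∈ s, x k • e k‖ ≤ (∑ k ∈ s, |x k| ^ (1 / α)) ^ α)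
    {w b : ℕ → ℝ} (hw : ∀ k, 0 ≤ w k) (hsum : Summable fun k => (w k * b k) ^ (1 / α))
    {S : Set (ℕ → ℝ)} (hS : ∀ x ∈ S, ∀ k, |x k| ≤ b k) :
    ∃ φ : S → E, Continuous φ ∧ ∀ ε > 0, ∃ F₀ : Finset ℕ, ∀ F, F₀ ⊆ F → ∀ x : S,
      ‖φ x - ∑ k ∈ F, (w k * x.1 k) • e k‖ ≤ ε := by
  have hsmall : ∀ ε > 0, ∃ F₀ : Finset ℕ, ∀ t, Disjoint t F₀ → ∀ x : S,
      ‖∑ k ∈ t, (w k * x.1 k) • e k‖ < ε := by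
    intro ε hε
    obtain ⟨F₀, hF₀⟩ := summable_iff_vanishing_norm.1 hsum (ε ^ (1 / α)) (by positivity)
    refine ⟨F₀, fun t ht x => (he t _).trans_lt ?_⟩
    have hle : ∑ k ∈ t, |w k * x.1 k| ^ (1 / α) ≤ ∑ k ∈ t, (w k * b k) ^ (1 / α) := by
      refine Finset.sum_le_sum fun k _ => Real.rpow_le_rpow (abs_nonneg _) ?_ (by positivity)
      rw [abs_mul, abs_of_nonneg (hw k)]
      exact mul_le_mul_of_nonneg_left (hS x x.2 k) (hw k)
    have h0 : 0 ≤ ∑ k ∈ t, |w k * x.1 k| ^ (1 / α) := Finset.sum_nonneg fun k _ => by positivity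
    have hlt := hle.trans_lt ((le_abs_self _).trans_lt (hF₀ t ht))
    calc _ < (ε ^ (1 / α)) ^ α := Real.rpow_lt_rpow h0 hlt hα
      _ = ε := by rw [← Real.rpow_mul hε.le, one_div_mul_cancel hα.ne', Real.rpow_one]
  have hsummable (x : S) : Summable fun k => (w k * x.1 k) • e k :=
    summable_iff_vanishing_norm.2 fun ε hε =>
      (hsmall ε hε).imp fun F₀ h t ht => h t ht x
  have happrox : ∀ ε > 0, ∃ F₀ : Finset ℕ, ∀ F, F₀ ⊆ F → ∀ x : S,
      ‖(∑' k, (w k * x.1 k) • e k) - ∑ k ∈ F, (w k * x.1 k) • e k‖ ≤ ε := by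
    intro ε hε
    obtain ⟨F₀, hF₀⟩ := hsmall ε hε
    refine ⟨F₀, fun F hF x => ?_⟩
    have hlim := ((hsummable x).hasSum.sub_const (∑ k ∈ F, (w k * x.1 k) • e k)).norm
    refine le_of_tendsto hlim ?_
    filter_upwards [eventually_ge_atTop F] with G hG
    rw [← Finset.sum_sdiff (show F ⊆ G from hG), add_sub_cancel_right]
    exact (hF₀ _ (Finset.disjoint_of_subset_right hF Finset.sdiff_disjoint) x).le
  refine ⟨fun x => ∑' k, (w k * x.1 k) • e k, ?_, happrox⟩
  have hunif : TendstoUniformly (fun (F : Finset ℕ) (x : S) => ∑ k ∈ F, (w k * x.1 k) • e k)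
      (fun x : S => ∑' k, (w k * x.1 k) • e k) atTop := by
    rw [Metric.tendstoUniformly_iff]
    intro ε hε
    obtain ⟨F₀, hF₀⟩ := happrox (ε / 2) (by positivity)
    filter_upwards [eventually_ge_atTop F₀] with F hF x
    rw [dist_eq_norm]
    linarith [hF₀ F hF x]
  refine hunif.continuous (Frequently.of_forall fun F => continuous_finsetSum _ fun k _ => ?_)
  exact (((continuous_apply k).comp continuous_subtype_val).const_mul _).smul continuous_const

/-- The operator into Euclidean space with given coordinate functionals. -/
noncomputable def operatorOfCoords {B : Type*} [NormedAddCommGroup B] [NormedSpace ℝ B] {N : ℕ}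
    (f : Fin N → StrongDual ℝ B) : B →L[ℝ] EuclideanSpace ℝ (Fin N) :=
  ∑ n, (f n).smulRight (EuclideanSpace.single n (1 : ℝ))

lemma operatorOfCoords_apply {B : Type*} [NormedAddCommGroup B] [NormedSpace ℝ B] {N : ℕ}
    (f : Fin N → StrongDual ℝ B) (z : B) (n : Fin N) : operatorOfCoords f z n = f n z := by
  simp [operatorOfCoords, Finset.sum_apply, Pi.single_apply]

lemma continuous_operatorOfCoords {B : Type*} [NormedAddCommGroup B] [NormedSpace ℝ B] {N : ℕ} :
    Continuous (operatorOfCoords : (Fin N → StrongDual ℝ B) → _) := by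
  unfold operatorOfCoords
  refine continuous_finsetSum _ fun n _ => ?_
  exact ((ContinuousLinearMap.smulRightL ℝ B (EuclideanSpace ℝ (Fin N))).flip
    (EuclideanSpace.single n 1)).continuous.comp (continuous_apply n)

end RandomOperator

/-! ### Small-ball estimates, Borel–Cantelli and prevalence. -/

section Prevalence

open scoped ENNReal

variable {B : Type*} [NormedAddCommGroup B] [NormedSpace ℝ B] {N : ℕ}

lemma measure_pi_small_ball_le {e : ℕ → StrongDual ℝ B} {w : ℕ → ℝ} {S : Set (ℕ → ℝ)}
    {φ : S → StrongDual ℝ B}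
    (hφ : ∀ ε > 0, ∃ F₀ : Finset ℕ, ∀ F, F₀ ⊆ F → ∀ x : S,
      ‖φ x - ∑ k ∈ F, (w k * x.1 k) • e k‖ ≤ ε)
    {C : ℝ} {ν : Measure S} [IsProbabilityMeasure ν]
    (hν : ∀ (F : Finset ℕ) (c : ℕ → ℝ) (σ a η : ℝ), 0 < σ → σ ^ 2 ≤ ∑ k ∈ F, c k ^ 2 → 0 ≤ η →
      ν {x | |a + ∑ k ∈ F, c k * x.1 k| ≤ η} ≤ ENNReal.ofReal (C * (η / σ)))
    (v : B →L[ℝ] EuclideanSpace ℝ (Fin N)) (z : B) {F₁ : Finset ℕ} {σ η : ℝ} (hσ : 0 < σ)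
    (hη : 0 < η) (h : σ ^ 2 ≤ ∑ k ∈ F₁, (w k * e k z) ^ 2) :
    Measure.pi (fun _ : Fin N => ν) {x | ‖(operatorOfCoords (fun n => φ (x n)) - v) z‖ ≤ η} ≤
      ENNReal.ofReal (C * (2 * η / σ)) ^ N := by
  classical
  -- Truncating the series changes its value at `z` by at most `η`, hence the window `2 * η`.
  -- Enlarging `F₁` to include `F₀` only increases the variance.
  obtain ⟨F₀, hF₀⟩ := hφ (η / (‖z‖ + 1)) (by positivity)
  set F := F₀ ∪ F₁ with hF
  have hsub : {x : Fin N → S | ‖(operatorOfCoords (fun n => φ (x n)) - v) z‖ ≤ η} ⊆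
      Set.univ.pi fun n => {x : S | |(-(v z n)) + ∑ k ∈ F, (w k * e k z) * x.1 k| ≤ 2 * η} := by
    intro x hx n _
    have h1 : |φ (x n) z - v z n| ≤ η := by
      have := (PiLp.norm_apply_le ((operatorOfCoords (fun n => φ (x n)) - v) z) n).trans hx
      simpa [operatorOfCoords_apply] using this
    have h2 : |φ (x n) z - ∑ k ∈ F, (w k * e k z) * (x n).1 k| ≤ η := by
      have := (φ (x n) - ∑ k ∈ F, (w k * (x n).1 k) • e k).le_of_opNorm_le
        (hF₀ F Finset.subset_union_left (x n)) z
      have heq : (φ (x n) - ∑ k ∈ F, (w k * (x n).1 k) • e k) z =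
          φ (x n) z - ∑ k ∈ F, (w k * e k z) * (x n).1 k := by
        simp only [sub_apply, sum_apply, smul_apply, smul_eq_mul]
        congr 1
        exact Finset.sum_congr rfl fun k _ => by ring
      rw [heq, Real.norm_eq_abs] at this
      refine this.trans ?_
      rw [div_mul_eq_mul_div, div_le_iff₀ (by positivity)]
      nlinarith
    have h3 : -(v z n) + ∑ k ∈ F, (w k * e k z) * (x n).1 k =
        (φ (x n) z - v z n) - (φ (x n) z - ∑ k ∈ F, (w k * e k z) * (x n).1 k) := by ring
    rw [Set.mem_ofPred_eq, h3]
    exact (abs_sub (φ (x n) z - v z n) _).trans (by linarith)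
  refine (measure_mono hsub).trans ?_
  rw [Measure.pi_pi]
  refine (Finset.prod_le_prod' fun n _ => hν F _ σ _ (2 * η) hσ (h.trans ?_) (by positivity)).trans
    (by simp)
  exact Finset.sum_le_sum_of_subset_of_nonneg Finset.subset_union_right fun _ _ _ => sq_nonneg _

/-- The operators that are eventually bounded below, with a logarithmic loss, on the dyadic shells
of `Z`. -/
def lowerBoundedOperators (γ : ℝ) (Z : Set B) (N : ℕ) : Set (B →L[ℝ] EuclideanSpace ℝ (Fin N)) :=
  {L | ∃ J : ℕ, ∀ j ≥ J, ∀ z ∈ dyadicShell Z j, (1 / 2) ^ j * (j + 1 : ℝ) ^ (-γ) ≤ ‖L z‖}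

lemma measurableSet_lowerBoundedOperators (γ : ℝ) (Z : Set B) :
    MeasurableSet (lowerBoundedOperators γ Z N) := by
  simp only [lowerBoundedOperators, Set.ofPred_exists]
  refine MeasurableSet.iUnion fun J => IsClosed.measurableSet ?_
  simp only [Set.ofPred_forall]
  refine isClosed_iInter fun j => isClosed_iInter fun _ => isClosed_iInter fun z =>
    isClosed_iInter fun _ => isClosed_le continuous_const ?_
  exact (ContinuousLinearMap.apply ℝ (EuclideanSpace ℝ (Fin N)) z).continuous.norm

lemma exists_dyadic_scale {t : ℝ} (h0 : 0 < t) (h1 : t ≤ 1) :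
    ∃ j : ℕ, (1 / 2 : ℝ) ^ (j + 1) < t ∧ t ≤ (1 / 2) ^ j :=
  exists_nat_pow_near_of_lt_one h0 h1 (by norm_num) (by norm_num)

lemma lowerBoundedOperators_subset {γ : ℝ} (hγ : 0 < γ) (X : Set B) :
    lowerBoundedOperators γ (X - X) N ⊆
      {L : B →L[ℝ] EuclideanSpace ℝ (Fin N) | IsAlmostBiLipschitzOn γ L X} := by
  rintro L ⟨J, hJ⟩
  have hlog2 : 0 < Real.log 2 := Real.log_pos one_lt_two
  set c₁ : ℝ := (Real.log 2 / 2) ^ γ with hc₁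
  have hc₁pos : 0 < c₁ := by positivity
  have hhalf : (1 / 2 : ℝ) ^ (J + 1) ≤ 1 / 2 := by
    rw [pow_succ]
    have : (1 / 2 : ℝ) ^ J ≤ 1 := pow_le_one₀ (by norm_num) (by norm_num)
    linarith
  -- This threshold forces `j > J`, so `j ≥ 1` and `j * log 2 ≥ (j + 1) * (log 2 / 2)`.
  refine ⟨c₁⁻¹ + ‖L‖, (1 / 2) ^ (J + 1), by positivity, by positivity, by linarith, ?_⟩
  intro x hx y hy hxy
  rw [← map_sub]
  refine ⟨?_, (L.le_opNorm _).trans (by gcongr; linarith [inv_pos.2 hc₁pos])⟩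
  rcases (norm_nonneg (x - y)).eq_or_lt with hz | hz
  · rw [← hz]; simp
  obtain ⟨j, hj1, hj2⟩ := exists_dyadic_scale hz (by linarith)
  have hJj : J < j := by
    by_contra! hle
    have := pow_le_pow_of_le_one (by norm_num : (0 : ℝ) ≤ 1 / 2) (by norm_num)
      (Nat.add_le_add_right hle 1)
    linarith
  have hL := hJ j hJj.le (x - y) ⟨Set.sub_mem_sub hx hy, hj1, hj2⟩
  have hjone : (1 : ℝ) ≤ j := by exact_mod_cast (Nat.zero_le J).trans_lt hJj
  have hlog : (j + 1 : ℝ) * (Real.log 2 / 2) ≤ |Real.log ‖x - y‖| := by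
    have h := Real.log_le_log hz hj2
    rw [Real.log_pow, one_div, Real.log_inv] at h
    rw [abs_of_nonpos (by nlinarith)]
    nlinarith
  have hpow : (j + 1 : ℝ) ^ γ * c₁ ≤ |Real.log ‖x - y‖| ^ γ := by
    rw [hc₁, ← Real.mul_rpow (by positivity) (by positivity)]
    exact Real.rpow_le_rpow (by positivity) hlog hγ.le
  refine le_trans ?_ hL
  calc 1 / (c₁⁻¹ + ‖L‖) * (‖x - y‖ / |Real.log ‖x - y‖| ^ γ)
      ≤ 1 / c₁⁻¹ * ((1 / 2) ^ j / ((j + 1 : ℝ) ^ γ * c₁)) := by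
        gcongr
        linarith [norm_nonneg L]
    _ = (1 / 2) ^ j * (j + 1 : ℝ) ^ (-γ) := by
        rw [Real.rpow_neg (by positivity)]
        field_simp

theorem isPrevalent_almostBiLipschitz [CompleteSpace B] {α : ℝ} (hα : 0 < α)
    (hB : HasNormingSequences B α) {X : Set B} {d γ : ℝ}
    (hd : assouadDim ↥(X - X) < (d : EReal)) (hdN : d < N) (hγ : (α * N + 1) / (N - d) < γ) :
    IsPrevalent {L : B →L[ℝ] EuclideanSpace ℝ (Fin N) | IsAlmostBiLipschitzOn γ L X} := by
  have hNd : 0 < (N : ℝ) - d := sub_pos.2 hdN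
  have hγ0 : 0 < γ := lt_trans (by positivity) hγ
  rw [div_lt_iff₀ hNd] at hγ
  have h0 : (X - X).Nonempty → (0 : B) ∈ X - X := by
    rintro ⟨_, x, hx, y, hy, rfl⟩
    exact ⟨x, hx, x, hx, sub_self x⟩
  -- The strict inequality on `γ` leaves room for `2δ`: one `δ` pays for the growth of the box, the
  -- other for summability of `(k+1)^(-(α+δ)/α)`.
  obtain ⟨δ, hδ, hβ⟩ : ∃ δ > 0, (α + 2 * δ) * N + 1 < γ * (N - d) := by
    refine ⟨(γ * (N - d) - (α * N + 1)) / (2 * (N + 1)), div_pos (by linarith) (by positivity), ?_⟩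
    set s := γ * (N - d) - (α * N + 1) with hs
    have : 2 * (s / (2 * ((N : ℝ) + 1))) * N < s := by
      have hs0 : 0 < s := by linarith
      rw [show 2 * (s / (2 * ((N : ℝ) + 1))) * N = s * (N / (N + 1)) by field_simp]
      exact mul_lt_of_lt_one_right hs0 ((div_lt_one (by positivity)).2 (by linarith))
    linarith
  set β := α + 2 * δ with hβdef
  have hβ0 : 0 < β := by positivity
  obtain ⟨u, K, hK, hu⟩ := exists_coarse_centres hd h0
  obtain ⟨M, hM, hfine⟩ := exists_fine_centres hd h0 hγ0
  choose t ht hcard hcov using hfine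
  obtain ⟨e, he, hnorming⟩ := hB u
  obtain ⟨A, C, hA, hC, ν, hνprob, hν⟩ := exists_probability_powerBox hδ
  have hsum : Summable fun k : ℕ =>
      ((k + 1 : ℝ) ^ (-β) * (A * (k + 1 : ℝ) ^ δ)) ^ (1 / α) := by
    have hs : Summable fun k : ℕ => A ^ (1 / α) * (((k + 1 : ℕ) : ℝ) ^ (-((α + δ) / α))) := by
      refine ((summable_nat_add_iff 1).2 (Real.summable_nat_rpow.2 ?_)).mul_left _
      rw [neg_lt_neg_iff, one_lt_div hα]
      linarith
    refine hs.congr fun k => ?_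
    push_cast
    rw [mul_left_comm, ← Real.rpow_add (by positivity), Real.mul_rpow hA.le (by positivity),
      ← Real.rpow_mul (by positivity)]
    congr 2
    rw [hβdef]; ring
  obtain ⟨φ, hφcont, hφ⟩ := exists_continuous_series hα he (S := powerBox A δ)
    (w := fun k => (k + 1 : ℝ) ^ (-β)) (fun k => by positivity) hsum (fun x hx => hx)
  have : CompactSpace (powerBox A δ) := isCompact_iff_compactSpace.1 (isCompact_powerBox A δ)
  set Ψ : (Fin N → powerBox A δ) → (B →L[ℝ] EuclideanSpace ℝ (Fin N)) :=
    fun x => operatorOfCoords fun n => φ (x n) with hΨ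
  have hΨcont : Continuous Ψ := continuous_operatorOfCoords.comp (by fun_prop)
  have hrange : IsCompact (Set.range Ψ) := isCompact_range hΨcont
  set Q : Measure (Fin N → powerBox A δ) := Measure.pi fun _ => ν with hQ
  refine ⟨lowerBoundedOperators γ (X - X) N, lowerBoundedOperators_subset hγ0 X,
    measurableSet_lowerBoundedOperators γ _, Q.map Ψ,
    Measure.isProbabilityMeasure_map hΨcont.measurable.aemeasurable,
    ⟨Set.range Ψ, hrange, ?_⟩, fun v => ?_⟩
  · rw [Measure.map_apply hΨcont.measurable hrange.measurableSet.compl]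
    convert measure_empty (μ := Q)
    ext x
    simp
  -- Compactness gives one Lipschitz constant for all the shifted operators, needed to pass from a
  -- point to a nearby net point.
  obtain ⟨R, hR⟩ : ∃ R : ℝ, ∀ x, ‖Ψ x - v‖ ≤ R := by
    obtain ⟨R, hR⟩ := (isCompact_range (hΨcont.sub continuous_const)).isBounded.exists_norm_le
    exact ⟨R, fun x => hR _ ⟨x, rfl⟩⟩
  set E : ℝ := C * (2 * ((1 + 2 * |R|) * 8 * (K : ℝ) ^ β)) with hE
  have hE0 : 0 ≤ E := by positivity
  have hbad (j : ℕ) : Q {x | ∃ z ∈ dyadicShell (X - X) j,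
      ‖(Ψ x - v) z‖ < (1 / 2) ^ j * (j + 1 : ℝ) ^ (-γ)} ≤
      ENNReal.ofReal (M * 2 ^ d * E ^ N * ((j + 1 : ℕ) : ℝ) ^ (γ * d + (β - γ) * N)) := by
    set ε : ℝ := (1 / 2) ^ j * (j + 1 : ℝ) ^ (-γ) with hε
    have hε0 : 0 < ε := by positivity
    set σ : ℝ := ((K : ℝ) * (j + 1)) ^ (-β) * (1 / 2) ^ (j + 3) with hσ
    have hKpos : (0 : ℝ) < K := by exact_mod_cast hK
    have hσ0 : 0 < σ := by positivity
    have hvar : ∀ z ∈ dyadicShell (X - X) j, ∃ F : Finset ℕ,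
        σ ^ 2 ≤ ∑ k ∈ F, ((k + 1 : ℝ) ^ (-β) * e k z) ^ 2 := by
      intro z hz
      obtain ⟨k, hk, hzk, huk⟩ := hu j z hz
      refine ⟨Finset.range (k + 1), ?_⟩
      calc σ ^ 2 ≤ (((K : ℝ) * (j + 1)) ^ (-β)) ^ 2 * ∑ i ∈ Finset.range (k + 1), (e i z) ^ 2 := by
            rw [hσ, mul_pow]
            refine mul_le_mul_of_nonneg_left ?_ (by positivity)
            exact (pow_le_pow_left₀ (by positivity) huk 2).trans (hnorming k z hzk)
        _ ≤ _ := by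
            rw [Finset.mul_sum]
            refine Finset.sum_le_sum fun i hi => ?_
            rw [mul_pow]
            refine mul_le_mul_of_nonneg_right (pow_le_pow_left₀ (by positivity) ?_ 2) (sq_nonneg _)
            -- The weights decrease, so all indices below `K * (j + 1)` have weight at least `(K *
            -- (j + 1)) ^ (-β)`.
            refine Real.rpow_le_rpow_of_nonpos (by positivity) ?_ (by linarith)
            have : i + 1 ≤ K * (j + 1) := by have := Finset.mem_range.1 hi; omega
            exact_mod_cast this
    have hsub : {x | ∃ z ∈ dyadicShell (X - X) j, ‖(Ψ x - v) z‖ < ε} ⊆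
        ⋃ c ∈ t j, {x | ‖(Ψ x - v) c‖ ≤ (1 + 2 * |R|) * ε} := by
      rintro x ⟨z, hz, hlt⟩
      obtain ⟨c, hc, hzc⟩ := hcov j z hz
      refine Set.mem_iUnion₂.2 ⟨c, hc, ?_⟩
      have h1 : ‖(Ψ x - v) (z - c)‖ ≤ |R| * (2 * ε) :=
        ((Ψ x - v).le_of_opNorm_le ((hR x).trans (le_abs_self R)) _).trans (by gcongr)
      have h2 : (Ψ x - v) c = (Ψ x - v) z - (Ψ x - v) (z - c) := by rw [map_sub, sub_sub_cancel]
      change ‖(Ψ x - v) c‖ ≤ _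
      rw [h2]
      exact (norm_sub_le _ _).trans (by linarith)
    have hratio : C * (2 * ((1 + 2 * |R|) * ε) / σ) = E * (j + 1 : ℝ) ^ (β - γ) := by
      rw [hE, hε, hσ, Real.mul_rpow hKpos.le (by positivity), Real.rpow_neg hKpos.le,
        Real.rpow_neg (by positivity : (0 : ℝ) ≤ j + 1), Real.rpow_neg (by positivity),
        Real.rpow_sub (by positivity), pow_add]
      field_simp
      norm_num
    have hball (c : B) (hc : c ∈ t j) : Q {x | ‖(Ψ x - v) c‖ ≤ (1 + 2 * |R|) * ε} ≤
        ENNReal.ofReal (E * (j + 1 : ℝ) ^ (β - γ)) ^ N := by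
      obtain ⟨F, hF⟩ := hvar c (ht j hc)
      rw [← hratio]
      exact measure_pi_small_ball_le hφ hν v c hσ0 (by positivity) hF
    calc _ ≤ ∑ c ∈ t j, Q {x | ‖(Ψ x - v) c‖ ≤ (1 + 2 * |R|) * ε} :=
          (measure_mono hsub).trans (measure_biUnion_finset_le _ _)
      _ ≤ ∑ _c ∈ t j, ENNReal.ofReal (E * (j + 1 : ℝ) ^ (β - γ)) ^ N := Finset.sum_le_sum hball
      _ = ENNReal.ofReal ((t j).card * (E * (j + 1 : ℝ) ^ (β - γ)) ^ N) := by
          rw [Finset.sum_const, nsmul_eq_mul, ENNReal.ofReal_mul (Nat.cast_nonneg _),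
            ENNReal.ofReal_natCast, ENNReal.ofReal_pow (by positivity)]
      _ ≤ ENNReal.ofReal (M * (2 * (j + 1 : ℝ) ^ γ) ^ d * (E * (j + 1 : ℝ) ^ (β - γ)) ^ N) := by
          gcongr
          exact hcard j
      _ = _ := by
          push_cast
          rw [Real.mul_rpow (by positivity) (by positivity), ← Real.rpow_mul (by positivity),
            mul_pow, ← Real.rpow_mul_natCast (by positivity), Real.rpow_add (by positivity)]
          congr 1
          ring
  have hae := ae_eventually_notMem (μ := Q) (s := fun j : ℕ => {x | ∃ z ∈ dyadicShell (X - X) j,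
      ‖(Ψ x - v) z‖ < (1 / 2) ^ j * (j + 1 : ℝ) ^ (-γ)}) <| by
    refine ne_top_of_le_ne_top ?_ (ENNReal.tsum_le_tsum hbad)
    refine Summable.tsum_ofReal_ne_top (Summable.mul_left _ ?_)
    -- The exponent is below `-1` precisely by `hβ`.
    exact (summable_nat_add_iff 1).2 (Real.summable_nat_rpow.2 (by linarith))
  have hmeas := measurable_const_add (-v) (measurableSet_lowerBoundedOperators γ (X - X) (N := N))
  rw [Set.image_add_left, Measure.map_apply hΨcont.measurable hmeas,
    ← mem_ae_iff_prob_eq_one (hΨcont.measurable hmeas)]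
  filter_upwards [hae] with x hx
  obtain ⟨J, hJ⟩ := Filter.eventually_atTop.1 hx
  refine ⟨J, fun j hj z hz => ?_⟩
  have := hJ j hj
  change _ ≤ ‖(-v + Ψ x) z‖
  rw [neg_add_eq_sub]
  by_contra! hlt
  exact this ⟨z, hz, hlt⟩

end Prevalence

theorem theorem3p1 :
    (∀ (B : Type*) [NormedAddCommGroup B] [NormedSpace ℝ B] [CompleteSpace B]
      (X : Set B) (N : ℕ) (d γ : ℝ),
      IsCompact X → assouadDim ↥(X - X) < (d : EReal) → d < N →
      (1 * N + 1) / (N - d) < γ →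
      IsPrevalent {L : B →L[ℝ] EuclideanSpace ℝ (Fin N) | IsAlmostBiLipschitzOn γ L X}) ∧
    (∀ (H : Type*) [NormedAddCommGroup H] [InnerProductSpace ℝ H] [CompleteSpace H]
      (X : Set H) (N : ℕ) (d γ : ℝ),
      IsCompact X → assouadDim ↥(X - X) < (d : EReal) → d < N →
      ((1 / 2 : ℝ) * N + 1) / (N - d) < γ →
      IsPrevalent {L : H →L[ℝ] EuclideanSpace ℝ (Fin N) | IsAlmostBiLipschitzOn γ L X}) :=
  ⟨fun B _ _ _ _ _ _ _ _ hd hdN hγ =>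
      isPrevalent_almostBiLipschitz one_pos (hasNormingSequences_one B) hd hdN hγ,
    fun H _ _ _ _ _ _ _ _ hd hdN hγ =>
      isPrevalent_almostBiLipschitz one_half_pos (hasNormingSequences_half H) hd hdN hγ⟩
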